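/- Let $(X,d)$ be a compact metric space and $T:X\to X$ a continuous map. For $n\in\mathbb N$, $x\in X$, $\epsilon>0$ put $$B_n(x,\epsilon)=\{y\in X:\ d(T^ix,T^iy)<\epsilon\ \text{ for all } 0\le i\le n-1\}.$$ Suppose that $T$ has the specification property: for each $\epsilon>0$ there is an integer $m=m(\epsilon)$ such that for any finite collection of intervals $I_j=[a_j,b_j]\subset\mathbb N$, $j=1,\dots,k$, with $a_{j+1}-b_j\ge m$ for $1\le j\le k-1$, and any $x_1,\dots,x_k\in X$, there is $x\in X$ with $d(T^{p+a_j}x,T^px_j)<\epsilon$ for all $0\le p\le b_j-a_j$ and all $1\le j\le k$. For $\alpha>0$ and $x_0\in X$ let $$\mathbf D^{x_0}_\alpha=\Big\{x\in X:\ \lim_{\epsilon\to0}\limsup_{n\to\infty}\frac{\max\{t\in\mathbb N:\ T^n(x)\in B_t(x_0,\epsilon)\}}{n}\ge\alpha\Big\},$$ where the maximum is $+\infty$ if the set of such $t$ is unbounded. For $Z\subset X$, the Bowen topological entropy of $Z$ is $h^B_{top}(Z)=\lim_{\epsilon\to0}\inf\{s\in\mathbb R:\ M(Z,s,\epsilon)=0\}$,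 where $$M(Z,s,\epsilon)=\lim_{N\to\infty}\ \inf_{\Gamma}\ \sum_{B_{n_i}(x_i,\epsilon)\in\Gamma}e^{-sn_i},$$ the infimum being over all finite or countable collections $\Gamma=\{B_{n_i}(x_i,\epsilon)\}_i$ with $x_i\in X$ and $n_i\ge N$ for all $i$ that cover $Z$. Let $h_{top}(T)\in[0,\infty]$ be the topological entropy of $T$. Then for every $\alpha>0$ and every $x_0\in X$, $$h^B_{top}(\mathbf D^{x_0}_\alpha)=\frac{h_{top}(T)}{1+\alpha},$$ where the right-hand side is $\infty$ if $h_{top}(T)=\infty$. -/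

import Mathlib

open Filter Topology
open scoped ENNReal

namespace SpecDyn

variable {X : Type*} [MetricSpace X]

/-- The Bowen ball `B_n(x, ε) = {y | d(T^i x, T^i y) < ε for all 0 ≤ i ≤ n - 1}`. -/
def bowenBall (T : X → X) (n : ℕ) (x : X) (ε : ℝ) : Set X :=
  {y | ∀ i < n, dist (T^[i] x) (T^[i] y) < ε}

/-- The specification property: for each `ε > 0` there is `m` such that for all finite families
of intervals `[a j, b j]` in `ℕ` with consecutive gaps at least `m`, and all points `x j`, some
`z` satisfies `d(T^(p + a j) z, T^p (x j)) < ε` for all `0 ≤ p ≤ b j - a j` and all `j`. -/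
def Specification (T : X → X) : Prop :=
  ∀ ε : ℝ, 0 < ε → ∃ m : ℕ, ∀ (k : ℕ) (a b : Fin k → ℕ) (x : Fin k → X),
    (∀ j, a j ≤ b j) →
    (∀ i j : Fin k, (i : ℕ) + 1 = (j : ℕ) → b i + m ≤ a j) →
    ∃ z : X, ∀ j : Fin k, ∀ p : ℕ, p ≤ b j - a j →
      dist (T^[p + a j] z) (T^[p] (x j)) < ε

/-- `max {t ∈ ℕ | y ∈ B_t(x₀, ε)}`, with value `∞` when `y` stays `ε`-close to the orbit of `x₀`
forever, so that every `t` is admissible. -/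
noncomputable def shadowTime (T : X → X) (x₀ : X) (ε : ℝ) (y : X) : ℝ≥0∞ :=
  ⨆ (t : ℕ) (_ : y ∈ bowenBall T t x₀ ε), (t : ℝ≥0∞)

/-- `limsup_{n → ∞} max {t ∈ ℕ | T^n x ∈ B_t(x₀, ε)} / n`. -/
noncomputable def shadowRateAt (T : X → X) (x₀ x : X) (ε : ℝ) : ℝ≥0∞ :=
  limsup (fun n : ℕ => shadowTime T x₀ ε (T^[n] x) / (n : ℝ≥0∞)) atTop

/-- The limit of `shadowRateAt T x₀ x ε` as `ε → 0+`; it is an infimum by monotonicity in `ε`,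
see `tendsto_shadowRateAt`. -/
noncomputable def shadowRate (T : X → X) (x₀ x : X) : ℝ≥0∞ :=
  ⨅ (ε : ℝ) (_ : 0 < ε), shadowRateAt T x₀ x ε

/-- The level set `D_α^{x₀}`. -/
def shadowSet (T : X → X) (x₀ : X) (α : ℝ) : Set X :=
  {x | ENNReal.ofReal α ≤ shadowRate T x₀ x}

/-- `M(Z, s, ε, N)`: the infimum of `∑ exp (-s n_i)` over all finite or countable collections of
Bowen balls `B_{n_i}(x_i, ε)` that cover `Z` and satisfy `n_i ≥ N`. A ball is recorded as the pair
`(x_i, n_i)`. -/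
noncomputable def coverSum (T : X → X) (Z : Set X) (s ε : ℝ) (N : ℕ) : ℝ≥0∞ :=
  ⨅ (Γ : Set (X × ℕ)) (_ : Γ.Countable) (_ : ∀ p ∈ Γ, N ≤ p.2)
    (_ : Z ⊆ ⋃ p ∈ Γ, bowenBall T p.2 p.1 ε),
    ∑' p : Γ, ENNReal.ofReal (Real.exp (-s * (p.1.2 : ℝ)))

/-- `M(Z, s, ε) = lim_{N → ∞} M(Z, s, ε, N)`, see `tendsto_coverSum`. -/
noncomputable def coverMeasure (T : X → X) (Z : Set X) (s ε : ℝ) : ℝ≥0∞ :=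
  ⨆ N : ℕ, coverSum T Z s ε N

/-- `h(Z, ε) = inf {s ∈ ℝ | M(Z, s, ε) = 0}`, an extended real number. -/
noncomputable def bowenEntropyAt (T : X → X) (Z : Set X) (ε : ℝ) : EReal :=
  ⨅ (s : ℝ) (_ : coverMeasure T Z s ε = 0), (s : EReal)

/-- The Bowen topological entropy of the subset `Z`: the limit of `h(Z, ε)` as `ε → 0+`; it is a
supremum by monotonicity in `ε`, see `tendsto_bowenEntropyAt`. -/
noncomputable def bowenEntropy (T : X → X) (Z : Set X) : EReal :=
  ⨆ (ε : ℝ) (_ : 0 < ε), bowenEntropyAt T Z ε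

theorem bowenBall_mono (T : X → X) (n : ℕ) (x : X) {ε δ : ℝ} (h : ε ≤ δ) :
    bowenBall T n x ε ⊆ bowenBall T n x δ :=
  fun _ hy i hi => (hy i hi).trans_le h

theorem tendsto_shadowRateAt (T : X → X) (x₀ x : X) :
    Tendsto (shadowRateAt T x₀ x) (𝓝[>] 0) (𝓝 (shadowRate T x₀ x)) := by
  have hm : Monotone (shadowRateAt T x₀ x) := by
    intro ε δ h
    refine limsup_le_limsup (Eventually.of_forall fun n => ?_)
    refine ENNReal.div_le_div_right ?_ _
    exact iSup_mono fun t => iSup_mono' fun ht => ⟨bowenBall_mono T t x₀ h ht, le_rfl⟩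
  have := hm.tendsto_nhdsGT 0
  rwa [sInf_image] at this

theorem tendsto_coverSum (T : X → X) (Z : Set X) (s ε : ℝ) :
    Tendsto (coverSum T Z s ε) atTop (𝓝 (coverMeasure T Z s ε)) := by
  refine tendsto_atTop_iSup fun N M h => ?_
  refine iInf_mono fun Γ => iInf_mono fun _ => iInf_mono' fun hN => ⟨fun p hp => ?_, le_rfl⟩
  exact h.trans (hN p hp)

theorem tendsto_bowenEntropyAt (T : X → X) (Z : Set X) :
    Tendsto (bowenEntropyAt T Z) (𝓝[>] 0) (𝓝 (bowenEntropy T Z)) := by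
  have hm : Antitone (bowenEntropyAt T Z) := by
    intro ε δ h
    refine iInf_mono fun s => iInf_mono' fun hs => ⟨?_, le_rfl⟩
    refine le_antisymm (le_trans ?_ hs.le) bot_le
    refine iSup_mono fun N => ?_
    refine iInf_mono fun Γ => iInf_mono fun _ => iInf_mono fun _ =>
      iInf_mono' fun hZ => ⟨hZ.trans ?_, le_rfl⟩
    exact Set.iUnion₂_mono fun p _ => bowenBall_mono T p.2 p.1 h
  have := hm.tendsto_nhdsGT 0
  rwa [sSup_image] at this

end SpecDyn

namespace SpecDyn

/-! Upper bound: for `β < α`, a point of the shadow set follows `x₀` for time `βn` after infinitely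
many times `n`. A Bowen ball of length `n` then determines one of length about `(1 + β)n`, so about
`exp (n h')` balls of that length cover the points returning at time `n`. Their weight `exp (n (h' -
s (1 + β)))` is summable once `s (1 + β) > h'`; see `coverMeasure_shadowSet_eq_zero`.

Lower bound: specification turns every array of choices from a finite separated set `E` into a point
of the shadow set, alternating long runs of free blocks with shadowing of `x₀` for `α` times the
elapsed time (`exists_shadow_schedule`). Rapidly growing runs give the free blocks any prescribed
density `θ < 1 / (1 + α)` at all late times (`IsSchedule.exists_blocks`). A Bowen ball of length `n`
fixes the choices in at least `θ n / r` blocks of period `r`, and the uniform product measure on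
arrays bounds the cover sum below (`one_le_tsum_of_cylinder_cover`). -/

/-! ### Upper bound -/

open Dynamics in
theorem eventually_exists_bowenBall_cover {X : Type*} [MetricSpace X] {T : X → X} {h : ℝ}
    (hh : coverEntropy T Set.univ < (h : EReal)) {ε : ℝ} (hε : 0 < ε) :
    ∀ᶠ n : ℕ in atTop, ∃ F : Finset X, (F.card : ℝ) ≤ Real.exp (n * h) ∧
      ∀ x, ∃ c ∈ F, x ∈ bowenBall T n c ε := by
  have h1 := (coverEntropyEntourage_le_coverEntropy T Set.univ
    (Metric.dist_mem_uniformity hε)).trans_lt hh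
  filter_upwards [ExpGrowth.eventually_le_exp h1] with n hn
  have he : EReal.exp ((h : EReal) * (n : EReal)) = ENNReal.ofReal (Real.exp (n * h)) := by
    rw [mul_comm (n : ℝ), ← EReal.exp_coe]; norm_cast
  rw [he] at hn
  have hlt : coverMincard T Set.univ {p : X × X | dist p.1 p.2 < ε} n < ⊤ := by
    rw [← ENat.toENNReal_lt, ENat.toENNReal_top]
    exact hn.trans_lt ENNReal.ofReal_lt_top
  obtain ⟨F, hF, hc⟩ := (coverMincard_finite_iff T _ _ n).1 hlt
  refine ⟨F, ?_, fun x => ?_⟩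
  · rw [← hc, ENat.toENNReal_coe, ENNReal.le_ofReal_iff_toReal_le (by simp) (Real.exp_pos _).le]
      at hn
    simpa using hn
  · obtain ⟨c, hc, hxc⟩ := hF (Set.mem_univ x)
    refine ⟨c, hc, fun i hi => ?_⟩
    have := mem_dynEntourage.1 hxc i hi
    rw [dist_comm]
    exact this

theorem bowenBall_antitone_time {X : Type*} [MetricSpace X] (T : X → X) (x : X) (ε : ℝ) :
    Antitone fun n => bowenBall T n x ε :=
  fun _ _ h _ hy i hi => hy i (hi.trans_le h)

theorem bowenBall_subset_of_mem {X : Type*} [MetricSpace X] {T : X → X} {n : ℕ} {c y : X} {ε : ℝ}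
    (hy : y ∈ bowenBall T n c (ε / 2)) : bowenBall T n c (ε / 2) ⊆ bowenBall T n y ε := by
  intro x hx i hi
  have h1 := hy i hi
  have h2 := hx i hi
  have := dist_triangle_left (T^[i] y) (T^[i] x) (T^[i] c)
  linarith

theorem mem_bowenBall_add {X : Type*} [MetricSpace X] {T : X → X} {n t : ℕ} {x y : X} {ε : ℝ} :
    x ∈ bowenBall T (n + t) y ε ↔
      x ∈ bowenBall T n y ε ∧ T^[n] x ∈ bowenBall T t (T^[n] y) ε := by
  constructor
  · refine fun h => ⟨fun i hi => h i (by omega), fun i hi => ?_⟩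
    rw [← Function.iterate_add_apply, ← Function.iterate_add_apply]
    exact h _ (by omega)
  · rintro ⟨h1, h2⟩ i hi
    by_cases hin : i < n
    · exact h1 i hin
    · have := h2 (i - n) (by omega)
      rwa [← Function.iterate_add_apply, ← Function.iterate_add_apply,
        Nat.sub_add_cancel (by omega)] at this

/-- Points of a Bowen ball which later shadow `x₀` lie in one longer Bowen ball. -/
theorem exists_bowenBall_supset {X : Type*} [MetricSpace X] (T : X → X) (x₀ c : X) (n t : ℕ)
    (ε : ℝ) : ∃ y : X, ∀ x, x ∈ bowenBall T n c (ε / 2) → T^[n] x ∈ bowenBall T t x₀ (ε / 2) →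
      x ∈ bowenBall T (n + t) y ε := by
  by_cases h : ∃ y, y ∈ bowenBall T n c (ε / 2) ∧ T^[n] y ∈ bowenBall T t x₀ (ε / 2)
  · obtain ⟨y, hy1, hy2⟩ := h
    exact ⟨y, fun x hx1 hx2 => mem_bowenBall_add.2
      ⟨bowenBall_subset_of_mem hy1 hx1, bowenBall_subset_of_mem hy2 hx2⟩⟩
  · push Not at h
    exact ⟨c, fun x hx1 hx2 => absurd hx2 (h x hx1)⟩

theorem frequently_mem_bowenBall_of_mem_shadowSet {X : Type*} [MetricSpace X] {T : X → X}
    {x₀ x : X} {α β ε : ℝ} (hβ : 0 ≤ β) (hβα : β < α) (hε : 0 < ε) (hx : x ∈ shadowSet T x₀ α) :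
    ∃ᶠ n : ℕ in atTop, T^[n] x ∈ bowenBall T ⌈β * n⌉₊ x₀ ε := by
  have h1 : ENNReal.ofReal β < shadowRateAt T x₀ x ε :=
    ((ENNReal.ofReal_lt_ofReal_iff (hβ.trans_lt hβα)).2 hβα).trans_le
      (le_trans hx (iInf₂_le ε hε))
  refine ((frequently_lt_of_lt_limsup (by isBoundedDefault) h1).and_eventually
    (eventually_gt_atTop 0)).mono ?_
  rintro n ⟨hn, hn0⟩
  rw [ENNReal.lt_div_iff_mul_lt (by simp) (by simp), shadowTime] at hn
  obtain ⟨t, ht⟩ := lt_iSup_iff.1 hn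
  obtain ⟨htb, ht⟩ := lt_iSup_iff.1 ht
  refine bowenBall_antitone_time T x₀ ε (Nat.ceil_le.2 ?_) htb
  rw [← ENNReal.ofReal_natCast, ← ENNReal.ofReal_natCast, ← ENNReal.ofReal_mul hβ] at ht
  exact ((ENNReal.ofReal_lt_ofReal_iff_of_nonneg (by positivity)).1 ht).le

theorem coverMeasure_shadowSet_eq_zero {X : Type*} [MetricSpace X] {T : X → X} {x₀ : X}
    {s α : ℝ} (hα : 0 < α) (h : Dynamics.coverEntropy T Set.univ < ((s * (1 + α) : ℝ) : EReal))
    {ε : ℝ} (hε : 0 < ε) : coverMeasure T (shadowSet T x₀ α) s ε = 0 := by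
  classical
  obtain ⟨h', hh', hlt⟩ := EReal.lt_iff_exists_real_btwn.1 h
  have hpos : 0 < h' := by
    exact_mod_cast (Dynamics.coverEntropy_nonneg T ⟨x₀, Set.mem_univ _⟩).trans_lt hh'
  have hlt : h' < s * (1 + α) := by exact_mod_cast hlt
  have hs : 0 < s := pos_of_mul_pos_left (hpos.trans hlt) (by positivity)
  -- The lower bound on `β` says `h' < s (1 + β)`; the difference `δ` is the decay rate of the
  -- weights.
  obtain ⟨β, hβ1, hβα⟩ : ∃ β, max 0 (h' / s - 1) < β ∧ β < α := by
    refine exists_between (max_lt hα ?_)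
    rw [sub_lt_iff_lt_add, div_lt_iff₀ hs]; linarith
  obtain ⟨hβ0, hβ1⟩ := max_lt_iff.1 hβ1
  rw [sub_lt_iff_lt_add, div_lt_iff₀ hs] at hβ1
  obtain ⟨δ, hδ0, hδ⟩ : ∃ δ : ℝ, 0 < δ ∧ h' + δ = s * (1 + β) :=
    ⟨s * (1 + β) - h', by linarith, by ring⟩
  obtain ⟨N₀, hN₀⟩ := eventually_atTop.1 (eventually_exists_bowenBall_cover hh' (half_pos hε))
  choose! F hF hFc using hN₀
  choose y hy using fun n c => exists_bowenBall_supset T x₀ c n ⌈β * n⌉₊ ε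
  have key : ∀ N, N₀ ≤ N → coverSum T (shadowSet T x₀ α) s ε N ≤
      ∑' k : ℕ, ENNReal.ofReal (Real.exp (-δ * ((k + N : ℕ) : ℝ))) := by
    intro N hN
    let G : ℕ → Finset (X × ℕ) := fun k =>
      (F (k + N)).image fun c => (y (k + N) c, (k + N) + ⌈β * (k + N : ℕ)⌉₊)
    refine (iInf₂_le_of_le (⋃ k, (G k : Set (X × ℕ)))
      (Set.countable_iUnion fun k => (G k).countable_toSet) ?_)
    refine iInf₂_le_of_le ?_ ?_ ?_
    · intro p hp
      obtain ⟨k, hk⟩ := Set.mem_iUnion.1 hp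
      obtain ⟨c, -, rfl⟩ := Finset.mem_image.1 (Finset.mem_coe.1 hk)
      dsimp only
      omega
    · intro x hx
      obtain ⟨n, hn, hxn⟩ := frequently_atTop.1
        (frequently_mem_bowenBall_of_mem_shadowSet hβ0.le hβα (half_pos hε) hx) N
      obtain ⟨k, rfl⟩ := Nat.exists_eq_add_of_le' hn
      obtain ⟨c, hc, hxc⟩ := hFc (k + N) (by omega) x
      exact Set.mem_biUnion (Set.mem_iUnion.2
        ⟨k, Finset.mem_coe.2 (Finset.mem_image_of_mem _ hc)⟩) (hy _ _ x hxc hxn)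
    · refine (ENNReal.tsum_iUnion_le_tsum
        (fun p : X × ℕ => ENNReal.ofReal (Real.exp (-s * (p.2 : ℝ)))) _).trans ?_
      refine ENNReal.tsum_le_tsum fun k => ?_
      rw [Finset.tsum_subtype' (G k) (fun p : X × ℕ => ENNReal.ofReal (Real.exp (-s * (p.2 : ℝ))))]
      have hle : ∀ p ∈ G k, ENNReal.ofReal (Real.exp (-s * (p.2 : ℝ))) ≤
          ENNReal.ofReal (Real.exp (-s * ((1 + β) * (k + N : ℕ)))) := by
        intro p hp
        obtain ⟨c, -, rfl⟩ := Finset.mem_image.1 hp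
        refine ENNReal.ofReal_le_ofReal (Real.exp_le_exp.2 ?_)
        have := Nat.le_ceil (β * (k + N : ℕ))
        rw [Nat.cast_add (k + N)]
        nlinarith
      refine (Finset.sum_le_card_nsmul _ _ _ hle).trans ?_
      rw [nsmul_eq_mul, ← ENNReal.ofReal_natCast, ← ENNReal.ofReal_mul (by positivity)]
      refine ENNReal.ofReal_le_ofReal ?_
      have hcard : ((G k).card : ℝ) ≤ Real.exp ((k + N : ℕ) * h') :=
        (Nat.cast_le.2 Finset.card_image_le).trans (hF _ (by omega))
      refine (mul_le_mul_of_nonneg_right hcard (Real.exp_pos _).le).trans (le_of_eq ?_)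
      rw [← Real.exp_add]
      congr 1
      have : δ = s * (1 + β) - h' := by linarith
      rw [this]; ring
  have hsum : ∑' k : ℕ, ENNReal.ofReal (Real.exp (-δ * (k : ℝ))) ≠ ∞ := by
    refine Summable.tsum_ofReal_ne_top ?_
    simpa [mul_comm] using Real.summable_exp_nat_mul_iff.2 (neg_lt_zero.2 hδ0)
  have hlim := ENNReal.tendsto_sum_nat_add _ hsum
  exact le_antisymm (le_of_tendsto_of_tendsto (tendsto_coverSum T _ s ε) hlim
    (eventually_atTop.2 ⟨N₀, key⟩)) bot_le

/-! ### Consequences of specification -/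

/-- `m` is a gap length which suffices for shadowing with precision `ε`. -/
def IsSpecGap {X : Type*} [MetricSpace X] (T : X → X) (ε : ℝ) (m : ℕ) : Prop :=
  ∀ (k : ℕ) (a b : Fin k → ℕ) (x : Fin k → X), (∀ j, a j ≤ b j) →
    (∀ i j : Fin k, (i : ℕ) + 1 = (j : ℕ) → b i + m ≤ a j) →
    ∃ z : X, ∀ j : Fin k, ∀ p : ℕ, p ≤ b j - a j → dist (T^[p + a j] z) (T^[p] (x j)) < ε

theorem IsSpecGap.exists_shadow_two {X : Type*} [MetricSpace X] {T : X → X} {ε : ℝ} {m : ℕ}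
    (hm : IsSpecGap T ε m) {b c d : ℕ} (hbc : b + m ≤ c) (hcd : c ≤ d) (x y : X) :
    ∃ z, (∀ p ≤ b, dist (T^[p] z) (T^[p] x) < ε) ∧
      ∀ p ≤ d - c, dist (T^[p + c] z) (T^[p] y) < ε := by
  obtain ⟨z, hz⟩ := hm 2 ![0, c] ![b, d] ![x, y] (by simp [Fin.forall_fin_two, hcd])
    (by simp [Fin.forall_fin_two, hbc])
  exact ⟨z, fun p hp => by simpa using hz 0 p (by simpa using hp),
    fun p hp => by simpa using hz 1 p (by simpa using hp)⟩

theorem IsSpecGap.exists_shadow_word {X : Type*} [MetricSpace X] {T : X → X} {ε : ℝ} {m : ℕ}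
    (hm : IsSpecGap T ε m) {q : ℕ} (hq : 0 < q) (N : ℕ) (e : ℕ → X) :
    ∃ z, ∀ i < N, ∀ p < q, dist (T^[p + i * (q + m)] z) (T^[p] (e i)) < ε := by
  obtain ⟨z, hz⟩ := hm N (fun i => i * (q + m)) (fun i => i * (q + m) + (q - 1)) (fun i => e i)
    (fun j => by simp) (fun i j hij => by
      simp only [← hij, add_mul, one_mul]
      omega)
  exact ⟨z, fun i hi p hp => hz ⟨i, hi⟩ p (by simp only [Nat.add_sub_cancel_left]; omega)⟩

/-- Specification along infinitely many intervals, with geometrically decreasing errors. -/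
theorem exists_shadow_seq {X : Type*} [MetricSpace X] [CompactSpace X] {T : X → X}
    (hT : Continuous T) {η : ℕ → ℝ} (hη0 : ∀ k, 0 ≤ η k) (hη : ∀ k, 2 * η (k + 1) ≤ η k)
    {m : ℕ → ℕ} (hm : ∀ k, IsSpecGap T (η k) (m k)) {A C : ℕ → ℕ} (hAC : ∀ k, A k ≤ C k)
    (hCA : ∀ k, C k + m (k + 1) ≤ A (k + 1)) (w : ℕ → X) :
    ∃ z, ∀ k, ∀ p ≤ C k - A k, dist (T^[p + A k] z) (T^[p] (w k)) ≤ 2 * η k := by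
  obtain ⟨y₀, hy₀⟩ := hm 0 1 ![A 0] ![C 0] ![w 0] (by simp [hAC]) (by simp)
  choose f hf₁ hf₂ using fun k y => (hm (k + 1)).exists_shadow_two (hCA k) (hAC (k + 1)) y (w (k + 1))
  let u : ℕ → X := fun k => Nat.rec y₀ f k
  have hu : ∀ k, u (k + 1) = f k (u k) := fun _ => rfl
  have hCmono : Monotone C := monotone_nat_of_le_succ fun k => by
    have := hCA k; have := hAC (k + 1); omega
  have hself : ∀ k, ∀ p ≤ C k - A k, dist (T^[p + A k] (u k)) (T^[p] (w k)) ≤ η k := by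
    intro k p hp
    cases k with
    | zero =>
      have h := hy₀ 0 p (by simpa using hp)
      simp only [Matrix.cons_val_fin_one] at h
      exact h.le
    | succ k => exact (hf₂ k _ p hp).le
  -- Subtracting `η (k + j)` makes the induction close: the next correction costs `η (k + j + 1)`,
  -- at most half of that reserve.
  have hlater : ∀ k j, ∀ p ≤ C k - A k,
      dist (T^[p + A k] (u (k + j))) (T^[p] (w k)) ≤ 2 * η k - η (k + j) := by
    intro k j p hp
    induction j with
    | zero => have := hself k p hp; simp only [add_zero]; linarith
    | succ j ih =>
      have h1 := hf₁ (k + j) (u (k + j)) (p + A k) (by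
        have := hCmono (Nat.le_add_right k j); have := hAC k; omega)
      have h2 := dist_triangle (T^[p + A k] (u (k + (j + 1)))) (T^[p + A k] (u (k + j)))
        (T^[p] (w k))
      have h3 := hη (k + j)
      rw [← hu] at h1
      rw [← add_assoc] at h2 ⊢
      linarith
  obtain ⟨z, -, φ, hφ, hlim⟩ := isCompact_univ.tendsto_subseq (x := u) fun _ => Set.mem_univ _
  refine ⟨z, fun k p hp => ?_⟩
  have hc : Tendsto (fun j => dist (T^[p + A k] (u (φ j))) (T^[p] (w k))) atTop
      (𝓝 (dist (T^[p + A k] z) (T^[p] (w k)))) :=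
    (((hT.iterate _).tendsto z).comp hlim).dist tendsto_const_nhds
  refine le_of_tendsto hc ((hφ.tendsto_atTop.eventually_ge_atTop k).mono fun j hj => ?_)
  obtain ⟨i, hi⟩ := Nat.exists_eq_add_of_le hj
  have := hlater k i p hp
  have := hη0 (k + i)
  rw [hi]
  linarith

/-! ### Schedules of free blocks -/

/-- Times for alternating `N k` free blocks of length `r`, started at time `A k`, with the shadowing
of a fixed orbit for the proportion `α` of the elapsed time; the free blocks of each stage have
density at least `θ` up to the beginning of the next one. -/
structure IsSchedule (α θ : ℝ) (r : ℕ) (m A N : ℕ → ℕ) : Prop where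
  next : ∀ k, A (k + 1) =
    (A k + N k * r + m k) + ⌈α * ((A k + N k * r + m k : ℕ) : ℝ)⌉₊ + m (k + 1)
  pos : ∀ k, 0 < N k
  density : ∀ k, θ * A (k + 1) + r ≤ N k * r

theorem exists_isSchedule {α θ : ℝ} (hα : 0 < α) (hθ : 0 ≤ θ) (hθα : θ * (1 + α) < 1) {r : ℕ}
    (hr : 0 < r) (m : ℕ → ℕ) : ∃ A N, IsSchedule α θ r m A N := by
  have step : ∀ k a : ℕ, ∃ N : ℕ, 0 < N ∧
      θ * (((a + N * r + m k) + ⌈α * ((a + N * r + m k : ℕ) : ℝ)⌉₊ + m (k + 1) : ℕ) : ℝ) + r ≤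
        N * r := by
    intro k a
    -- In the density inequality `N * r` has net coefficient `1 - θ * (1 + α) > 0`, so a large `N`
    -- beats the terms independent of it.
    obtain ⟨N, hN⟩ := exists_nat_ge
      ((θ * ((1 + α) * (a + m k) + 1 + m (k + 1)) + r) / (1 - θ * (1 + α)))
    rw [div_le_iff₀ (by linarith)] at hN
    have hr1 : (1 : ℝ) ≤ r := by exact_mod_cast hr
    have hN0 : 0 < N := by
      rcases Nat.eq_zero_or_pos N with rfl | h
      · have : 0 ≤ θ * ((1 + α) * (a + m k) + 1 + m (k + 1)) := by positivity
        simp only [Nat.cast_zero, zero_mul] at hN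
        linarith
      · exact h
    refine ⟨N, hN0, ?_⟩
    have hc := (Nat.ceil_lt_add_one
      (by positivity : 0 ≤ α * ((a + N * r + m k : ℕ) : ℝ))).le
    have h1 := mul_le_mul_of_nonneg_left hc hθ
    have h2 : (N : ℝ) * (1 - θ * (1 + α)) ≤ N * (1 - θ * (1 + α)) * r :=
      le_mul_of_one_le_right (mul_nonneg (Nat.cast_nonneg _) (by linarith)) hr1
    push_cast at h1 ⊢
    nlinarith
  choose f hf0 hf using step
  let A : ℕ → ℕ := fun k => Nat.rec 0
    (fun k a => (a + f k a * r + m k) + ⌈α * ((a + f k a * r + m k : ℕ) : ℝ)⌉₊ + m (k + 1)) k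
  exact ⟨A, fun k => f k (A k), fun k => rfl, fun k => hf0 _ _, fun k => hf _ _⟩

namespace IsSchedule

variable {α θ : ℝ} {r : ℕ} {m A N : ℕ → ℕ}

theorem add_mul_le (h : IsSchedule α θ r m A N) (k : ℕ) : A k + N k * r ≤ A (k + 1) := by
  rw [h.next]; omega

theorem strictMono (h : IsSchedule α θ r m A N) (hr : 0 < r) : StrictMono A :=
  strictMono_nat_of_lt_succ fun k => by
    have := h.add_mul_le k
    have := Nat.mul_pos (h.pos k) hr
    omega

theorem exists_blocks (h : IsSchedule α θ r m A N) (hr : 0 < r) (hθ : 0 ≤ θ) (hθ1 : θ ≤ 1) {n : ℕ}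
    (hn : A 1 ≤ n) : ∃ S : Finset (ℕ × ℕ),
      (∀ p ∈ S, p.2 < N p.1 ∧ A p.1 + (p.2 + 1) * r ≤ n) ∧ θ * n ≤ r * S.card := by
  have hmono := h.strictMono hr
  obtain ⟨j, hj1, hj2⟩ : ∃ j, A (j + 1) ≤ n ∧ n < A (j + 2) := by
    have hex : ∃ k, n < A k := ⟨n + 1, hmono.le_apply⟩
    have h2 := Nat.find_spec hex
    have h3 : 2 ≤ Nat.find hex := by
      by_contra hlt
      have := hmono.monotone (show Nat.find hex ≤ 1 by omega)
      omega
    obtain ⟨j, hj⟩ := Nat.exists_eq_add_of_le' h3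
    exact ⟨j, not_lt.1 (Nat.find_min hex (by omega)), hj ▸ h2⟩
  -- The number of blocks of the current stage completed by time `n`.
  set d := min (N (j + 1)) ((n - A (j + 1)) / r) with hd
  refine ⟨{j} ×ˢ Finset.range (N j) ∪ {j + 1} ×ˢ Finset.range d, ?_, ?_⟩
  · rintro ⟨k, i⟩ hp
    simp only [Finset.mem_union, Finset.mem_product, Finset.mem_singleton, Finset.mem_range] at hp
    rcases hp with ⟨rfl, hi⟩ | ⟨rfl, hi⟩
    · have h1 := h.add_mul_le k
      have h2 : (i + 1) * r ≤ N k * r := Nat.mul_le_mul_right _ hi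
      exact ⟨hi, by dsimp only; omega⟩
    · have h2 : (i + 1) * r ≤ n - A (j + 1) :=
        (Nat.le_div_iff_mul_le hr).1 (hi.trans_le (min_le_right _ _))
      exact ⟨hi.trans_le (min_le_left _ _), by dsimp only; omega⟩
  · rw [Finset.card_union_of_disjoint]
    · simp only [Finset.card_product, Finset.card_singleton, Finset.card_range, one_mul]
      have h1 := h.density j
      have h2 := h.density (j + 1)
      have hr0 : (0 : ℝ) ≤ r := Nat.cast_nonneg _
      -- If the current run is complete, its own density bound suffices up to `A (j + 2)`. Otherwise
      -- less than one block is lost, which the spare `r` in the density bound of stage `j` absorbs.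
      rcases min_choice (N (j + 1)) ((n - A (j + 1)) / r) with hc | hc
      · rw [hd, hc]
        have : (n : ℝ) ≤ A (j + 1 + 1) := by exact_mod_cast hj2.le
        have := mul_le_mul_of_nonneg_left this hθ
        have : 0 ≤ (r : ℝ) * N j := by positivity
        push_cast
        nlinarith
      · rw [hd, hc]
        have h3 : n < A (j + 1) + r * ((n - A (j + 1)) / r) + r := by
          have := Nat.lt_mul_div_succ (n - A (j + 1)) hr
          rw [Nat.mul_succ] at this
          omega
        have h3 : (n : ℝ) ≤ A (j + 1) + r * (((n - A (j + 1)) / r : ℕ) : ℝ) + r := by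
          exact_mod_cast h3.le
        have h4 : (A (j + 1) : ℝ) ≤ n := by exact_mod_cast hj1
        have h5 : θ * (n - A (j + 1)) ≤ n - A (j + 1) :=
          mul_le_of_le_one_left (by linarith) hθ1
        push_cast
        nlinarith
    · rw [Finset.disjoint_left]
      rintro ⟨k, i⟩ h1 h2
      simp only [Finset.mem_product, Finset.mem_singleton] at h1 h2
      omega

end IsSchedule

/-! ### Counting on a full shift -/

open MeasureTheory in
/-- If countably many sets cover a full shift, and all elements of the `j`-th set agree on the
finite set `S j` of coordinates, then `∑ |E| ^ (-|S j|) ≥ 1`. -/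
theorem one_le_tsum_of_cylinder_cover {I E J : Type*} [Fintype E] [Nonempty E] [Countable J]
    (S : J → Finset I) (V : J → Set (I → E)) (hV : ⋃ j, V j = Set.univ)
    (hS : ∀ j, ∀ ω ∈ V j, ∀ ω' ∈ V j, ∀ i ∈ S j, ω i = ω' i) :
    1 ≤ ∑' j, ((Fintype.card E : ℝ≥0∞)⁻¹) ^ (S j).card := by
  let _ : MeasurableSpace E := ⊤
  let ν : Measure E := (PMF.uniformOfFintype E).toMeasure
  let μ : Measure (I → E) := Measure.infinitePi fun _ => ν
  have hsub : ∀ j, μ (V j) ≤ ((Fintype.card E : ℝ≥0∞)⁻¹) ^ (S j).card := by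
    intro j
    rcases (V j).eq_empty_or_nonempty with h | ⟨ω, hω⟩
    · simp [h]
    · calc μ (V j) ≤ μ (Set.pi (S j) fun i => {ω i}) :=
            measure_mono fun ω' hω' i hi => hS j ω' hω' ω hω i hi
        _ = ∏ i ∈ S j, ν {ω i} := Measure.infinitePi_pi _ fun _ _ => trivial
        _ = ((Fintype.card E : ℝ≥0∞)⁻¹) ^ (S j).card := by
          have : ∀ e : E, ν {e} = (Fintype.card E : ℝ≥0∞)⁻¹ := fun e => by
            have he : MeasurableSet {e} := trivial
            rw [PMF.toMeasure_apply_singleton _ _ he, PMF.uniformOfFintype_apply]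
          simp [this]
  -- Countable subadditivity holds for arbitrary sets, so the `V j` need not be measurable, nor does
  -- the later coding map.
  calc (1 : ℝ≥0∞) = μ (⋃ j, V j) := by rw [hV, measure_univ]
    _ ≤ ∑' j, μ (V j) := measure_iUnion_le _
    _ ≤ _ := ENNReal.tsum_le_tsum hsub

/-! ### Lower bound -/

theorem mem_shadowSet_of_frequently {X : Type*} [MetricSpace X] {T : X → X} {x₀ z : X} {α : ℝ}
    (hα : 0 ≤ α) (h : ∀ ε > 0, ∃ᶠ n : ℕ in atTop, T^[n] z ∈ bowenBall T ⌈α * n⌉₊ x₀ ε) :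
    z ∈ shadowSet T x₀ α := by
  change ENNReal.ofReal α ≤ shadowRate T x₀ z
  refine le_iInf₂ fun ε hε => ?_
  refine le_limsup_of_frequently_le ?_
  refine ((h ε hε).and_eventually (eventually_gt_atTop 0)).mono ?_
  rintro n ⟨hn, hn0⟩
  rw [ENNReal.le_div_iff_mul_le (by simp [hn0.ne']) (by simp)]
  refine le_trans ?_ (le_iSup₂ (f := fun (t : ℕ) (_ : T^[n] z ∈ bowenBall T t x₀ ε) => (t : ℝ≥0∞))
    _ hn)
  rw [← ENNReal.ofReal_natCast, ← ENNReal.ofReal_natCast, ← ENNReal.ofReal_mul hα]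
  exact ENNReal.ofReal_le_ofReal (Nat.le_ceil _)

/-- Two precisions are needed. Free blocks are joined at the fixed precision `ε`, which keeps their
period constant. Each run is glued to the orbit of `x₀`, and the stages to each other, at precision
`ε / 2 ^ k`, so that `x₀` is shadowed with errors tending to zero. -/
theorem exists_shadow_schedule {X : Type*} [MetricSpace X] [CompactSpace X] {T : X → X}
    (hT : Continuous T) {α θ ε : ℝ} (hα : 0 ≤ α) (hε : 0 < ε) {m₀ q : ℕ} (hm₀ : IsSpecGap T ε m₀)
    (hq : 0 < q) {m A N : ℕ → ℕ} (hm : ∀ k, IsSpecGap T (ε / 2 ^ k) (m k))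
    (h : IsSchedule α θ (q + m₀) m A N) (x₀ : X) (w : ℕ → ℕ → X) :
    ∃ z ∈ shadowSet T x₀ α, ∀ k, ∀ i < N k, ∀ p < q,
      dist (T^[p + (A k + i * (q + m₀))] z) (T^[p] (w k i)) < 4 * ε := by
  choose y hy using fun k => hm₀.exists_shadow_word hq (N k) (w k)
  let B : ℕ → ℕ := fun k => N k * (q + m₀) + m k
  let t : ℕ → ℕ := fun k => ⌈α * ((A k + B k : ℕ) : ℝ)⌉₊
  choose v hv₁ hv₂ using fun k =>
    (hm k).exists_shadow_two (le_refl (B k)) (Nat.le_add_right (B k) (t k)) (y k) x₀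
  have hnext : ∀ k, A (k + 1) = A k + B k + t k + m (k + 1) := fun k => by
    rw [h.next k]; simp only [t, B, add_assoc]
  obtain ⟨z, hz⟩ := exists_shadow_seq hT (η := fun k => ε / 2 ^ k) (fun k => by positivity)
    (fun k => by rw [pow_succ]; exact le_of_eq (by field_simp)) hm
    (A := A) (C := fun k => A k + B k + t k) (fun k => by omega) (fun k => (hnext k).ge) v
  have hle : ∀ k, ε / 2 ^ k ≤ ε := fun k => div_le_self hε.le (one_le_pow₀ one_le_two)
  refine ⟨z, mem_shadowSet_of_frequently hα fun δ hδ => frequently_atTop.2 fun n => ?_, ?_⟩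
  · have hlim : Tendsto (fun k : ℕ => 3 * (ε / 2 ^ k)) atTop (𝓝 0) := by
      have := (tendsto_pow_atTop_nhds_zero_of_lt_one (r := (1 / 2 : ℝ)) (by norm_num)
        (by norm_num)).const_mul (3 * ε)
      simp only [mul_zero, one_div, inv_pow] at this
      simpa only [div_eq_mul_inv, mul_assoc] using this
    obtain ⟨k, hk, hkn⟩ := ((hlim.eventually (gt_mem_nhds hδ)).and (eventually_ge_atTop n)).exists
    refine ⟨A k + B k, ?_, fun p hp => ?_⟩
    · have := (h.strictMono (by omega)).le_apply (x := k)
      omega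
    · have hp : p < t k := hp
      have h1 := hz k (p + B k) (by omega)
      have h2 := hv₂ k p (by omega)
      have h3 := dist_triangle_left (T^[p] x₀) (T^[p + B k + A k] z) (T^[p + B k] (v k))
      rw [← Function.iterate_add_apply]
      rw [show p + (A k + B k) = p + B k + A k by ring]
      rw [dist_comm] at h1
      linarith
  · intro k i hi p hp
    have hip : p + i * (q + m₀) ≤ N k * (q + m₀) := by
      have : (i + 1) * (q + m₀) ≤ N k * (q + m₀) := Nat.mul_le_mul_right _ hi
      rw [add_mul] at this
      omega
    have hBk : B k = N k * (q + m₀) + m k := rfl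
    have h1 := hz k (p + i * (q + m₀)) (by omega)
    have h2 := hv₁ k (p + i * (q + m₀)) (by omega)
    have h3 := hy k i hi p hp
    have h4 := dist_triangle4 (T^[p + i * (q + m₀) + A k] z) (T^[p + i * (q + m₀)] (v k))
      (T^[p + i * (q + m₀)] (y k)) (T^[p] (w k i))
    rw [show p + (A k + i * (q + m₀)) = p + i * (q + m₀) + A k by ring]
    have := hle k
    linarith

/-- The constant `10` is `4 + 4 + 2`: two coded points in one `ε`-ball are `2ε`-close along it, and
each is `4ε`-close to its chosen block, so all blocks finished within the ball agree. -/
theorem exists_one_le_coverSum {X : Type*} [MetricSpace X] [CompactSpace X] {T : X → X}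
    (hT : Continuous T) (hspec : Specification T) {α θ s ε : ℝ} (hα : 0 < α) (hθ : 0 ≤ θ)
    (hθα : θ * (1 + α) < 1) (hε : 0 < ε) {m₀ q : ℕ} (hm₀ : IsSpecGap T ε m₀) (hq : 0 < q)
    (E : Finset X) (hE : E.Nonempty)
    (hsep : ∀ x ∈ E, ∀ y ∈ E, y ∈ bowenBall T q x (10 * ε) → x = y)
    (hs : s * (q + m₀ : ℕ) ≤ θ * Real.log E.card) (x₀ : X) :
    ∃ n₀, ∀ n ≥ n₀, 1 ≤ coverSum T (shadowSet T x₀ α) s ε n := by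
  choose m hm using fun k : ℕ => hspec (ε / 2 ^ k) (by positivity)
  have hr : 0 < q + m₀ := by omega
  obtain ⟨A, N, hAN⟩ := exists_isSchedule hα hθ hθα hr m
  have := hE.to_subtype
  choose z hzD hz using fun ω : ℕ × ℕ → E =>
    exists_shadow_schedule hT hα.le hε hm₀ hq hm hAN x₀ fun k i => (ω (k, i) : X)
  have hcard : Fintype.card E = E.card := Fintype.card_coe E
  have hlog : 0 ≤ Real.log E.card := Real.log_natCast_nonneg _
  have hEpos : (0 : ℝ) < E.card := by exact_mod_cast hE.card_pos
  refine ⟨A 1, fun n hn => le_iInf₂ fun Γ hΓ => le_iInf₂ fun hΓn hcov => ?_⟩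
  have := hΓ.to_subtype
  choose S hS hSc using fun p : Γ => hAN.exists_blocks hr hθ (by nlinarith) (hn.trans (hΓn p p.2))
  refine (one_le_tsum_of_cylinder_cover S
    (fun p : Γ => {ω : ℕ × ℕ → E | z ω ∈ bowenBall T p.1.2 p.1.1 ε}) ?_ ?_).trans
    (ENNReal.tsum_le_tsum fun p => ?_)
  · refine Set.eq_univ_of_forall fun ω => ?_
    obtain ⟨p, hp, hzp⟩ := Set.mem_iUnion₂.1 (hcov (hzD ω))
    exact Set.mem_iUnion.2 ⟨⟨p, hp⟩, hzp⟩
  · rintro p ω hω ω' hω' ⟨k, i⟩ hki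
    obtain ⟨hi, hle⟩ := hS p _ hki
    refine Subtype.ext (hsep _ (ω _).2 _ (ω' _).2 fun j hj => ?_)
    have hjn : j + (A k + i * (q + m₀)) < p.1.2 := by
      dsimp only at hle
      rw [add_mul] at hle
      omega
    have h1 := hω _ hjn
    have h2 := hω' _ hjn
    have h3 := hz ω k i hi j hj
    have h4 := hz ω' k i hi j hj
    have h5 := dist_triangle_left (T^[j] (ω (k, i) : X)) (T^[j] (ω' (k, i) : X))
      (T^[j + (A k + i * (q + m₀))] (z ω))
    have h6 := dist_triangle (T^[j + (A k + i * (q + m₀))] (z ω))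
      (T^[j + (A k + i * (q + m₀))] (z ω')) (T^[j] (ω' (k, i) : X))
    have h7 := dist_triangle_left (T^[j + (A k + i * (q + m₀))] (z ω))
      (T^[j + (A k + i * (q + m₀))] (z ω')) (T^[j + (A k + i * (q + m₀))] p.1.1)
    linarith
  · have hEinv : ((E.card : ℝ≥0∞)⁻¹) = ENNReal.ofReal (Real.exp (-Real.log E.card)) := by
      rw [Real.exp_neg, Real.exp_log hEpos, ENNReal.ofReal_inv_of_pos hEpos,
        ENNReal.ofReal_natCast]
    rw [hcard, hEinv, ← ENNReal.ofReal_pow (Real.exp_pos _).le, ← Real.exp_nat_mul]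
    refine ENNReal.ofReal_le_ofReal (Real.exp_le_exp.2 ?_)
    have h1 := hSc p
    have h2 := mul_le_mul_of_nonneg_right hs (Nat.cast_nonneg p.1.2 : (0 : ℝ) ≤ _)
    have h3 := mul_le_mul_of_nonneg_right h1 hlog
    have hr' : (0 : ℝ) < (q + m₀ : ℕ) := by exact_mod_cast hr
    have h4 : (q + m₀ : ℕ) * (s * p.1.2) ≤ (q + m₀ : ℕ) * ((S p).card * Real.log E.card) := by
      nlinarith
    have h5 := le_of_mul_le_mul_left h4 hr'
    linarith

theorem le_bowenEntropyAt {X : Type*} [MetricSpace X] {T : X → X} {Z : Set X} {s ε : ℝ}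
    (h : coverMeasure T Z s ε ≠ 0) : (s : EReal) ≤ bowenEntropyAt T Z ε := by
  refine le_iInf₂ fun s' hs' => EReal.coe_le_coe_iff.2 (le_of_not_gt fun hlt => h ?_)
  refine le_antisymm (le_trans ?_ hs'.le) bot_le
  refine iSup_mono fun n => iInf_mono fun Γ => iInf_mono fun _ => iInf_mono fun _ =>
    iInf_mono fun _ => ENNReal.tsum_le_tsum fun p =>
    ENNReal.ofReal_le_ofReal (Real.exp_le_exp.2 ?_)
  have : (0 : ℝ) ≤ p.1.2 := Nat.cast_nonneg _
  nlinarith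

-- Infinitely many lengths `n` suffice, since the construction uses only one sufficiently large
-- block length.
open Dynamics in
theorem exists_frequently_separated {X : Type*} [MetricSpace X] {T : X → X} {h : ℝ}
    (hh : (h : EReal) < coverEntropy T Set.univ) :
    ∃ δ > 0, ∃ᶠ n : ℕ in atTop, ∃ E : Finset X, Real.exp (n * h) ≤ E.card ∧
      ∀ x ∈ E, ∀ y ∈ E, y ∈ bowenBall T n x δ → x = y := by
  obtain ⟨h', hh', hlt⟩ := EReal.lt_iff_exists_real_btwn.1 hh
  rw [coverEntropy_eq_iSup_basis_netEntropyEntourage Metric.uniformity_basis_dist] at hlt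
  obtain ⟨δ, hlt⟩ := lt_iSup_iff.1 hlt
  obtain ⟨hδ, hlt⟩ := lt_iSup_iff.1 hlt
  refine ⟨δ, hδ, ((ExpGrowth.frequently_exp_le hlt).and_eventually
    (eventually_gt_atTop 0)).mono ?_⟩
  rintro n ⟨hn, hn0⟩
  have he : EReal.exp ((h' : EReal) * (n : EReal)) = ENNReal.ofReal (Real.exp (n * h')) := by
    rw [mul_comm (n : ℝ), ← EReal.exp_coe]; norm_cast
  have hexp : Real.exp (n * h) < Real.exp (n * h') :=
    Real.exp_lt_exp.2 (mul_lt_mul_of_pos_left (EReal.coe_lt_coe_iff.1 hh') (by exact_mod_cast hn0))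
  -- `netMaxcard` is a supremum, possibly infinite; a strict bound by the ceiling minus one extracts
  -- a finite net that is large enough.
  have hlt : ((⌈Real.exp (n * h)⌉₊ - 1 : ℕ) : ℕ∞) <
      netMaxcard T Set.univ {p : X × X | dist p.1 p.2 < δ} n := by
    rw [← ENat.toENNReal_lt, ENat.toENNReal_coe]
    refine lt_of_lt_of_le ?_ hn
    rw [he, ← ENNReal.ofReal_natCast, ENNReal.ofReal_lt_ofReal_iff (Real.exp_pos _)]
    refine lt_trans ?_ hexp
    exact Nat.lt_ceil.1 (Nat.sub_lt (Nat.ceil_pos.2 (Real.exp_pos _)) one_pos)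
  obtain ⟨E, hE⟩ := lt_iSup_iff.1 hlt
  obtain ⟨hnet, hE⟩ := lt_iSup_iff.1 hE
  have hE : ⌈Real.exp (n * h)⌉₊ - 1 < E.card := by exact_mod_cast hE
  refine ⟨E, Nat.ceil_le.1 (by omega), fun x hx y hy hxy => ?_⟩
  refine hnet.2.elim_set hx hy y (mem_ball_dynEntourage.2 fun k hk => hxy k hk)
    (mem_ball_dynEntourage.2 fun k hk => ?_)
  change dist _ _ < δ
  rwa [dist_self]

theorem le_bowenEntropy_shadowSet {X : Type*} [MetricSpace X] [CompactSpace X] {T : X → X}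
    (hT : Continuous T) (hspec : Specification T) {α s : ℝ} (hα : 0 < α) (x₀ : X)
    (hs : ((s * (1 + α) : ℝ) : EReal) < Dynamics.coverEntropy T Set.univ) :
    (s : EReal) ≤ bowenEntropy T (shadowSet T x₀ α) := by
  obtain ⟨h, hsh, hh⟩ := EReal.lt_iff_exists_real_btwn.1 hs
  have hsh : s * (1 + α) < h := by exact_mod_cast hsh
  obtain ⟨δ, hδ, hfreq⟩ := exists_frequently_separated hh
  set ε := δ / 10 with hεδ
  have hε : 0 < ε := by positivity
  obtain ⟨m₀, hm₀⟩ : ∃ m₀, IsSpecGap T ε m₀ := hspec ε hε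
  -- For `s > 0`, take `s / h < θ < 1 / (1 + α)`; the surplus `q (θ h - s)` pays for the gap `m₀`
  -- once `q` is large.
  obtain ⟨θ, hθ, hθα, hev⟩ : ∃ θ : ℝ, 0 ≤ θ ∧ θ * (1 + α) < 1 ∧
      ∀ᶠ q : ℕ in atTop, ∀ L : ℝ, 0 ≤ L → q * h ≤ L → s * (q + m₀ : ℕ) ≤ θ * L := by
    rcases le_or_gt s 0 with hs0 | hs0
    · refine ⟨0, le_rfl, by simp, Eventually.of_forall fun q L _ _ => ?_⟩
      rw [zero_mul]
      exact mul_nonpos_of_nonpos_of_nonneg hs0 (Nat.cast_nonneg _)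
    · have hh0 : 0 < h := lt_trans (by positivity) hsh
      obtain ⟨θ, hθ1, hθ2⟩ : ∃ θ, s / h < θ ∧ θ < 1 / (1 + α) := by
        refine exists_between ?_
        rw [div_lt_div_iff₀ hh0 (by positivity)]
        linarith
      rw [lt_div_iff₀ (by positivity)] at hθ2
      have hθ0 : 0 < θ := lt_trans (by positivity) hθ1
      rw [div_lt_iff₀ hh0] at hθ1
      refine ⟨θ, hθ0.le, hθ2, ?_⟩
      filter_upwards [tendsto_natCast_atTop_atTop.eventually_ge_atTop
        (s * m₀ / (θ * h - s))] with q hq L _ hL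
      rw [div_le_iff₀ (by linarith)] at hq
      have := mul_le_mul_of_nonneg_left hL hθ0.le
      push_cast
      nlinarith
  obtain ⟨q, ⟨E, hEc, hsep⟩, hq, hq0⟩ :=
    (hfreq.and_eventually (hev.and (eventually_gt_atTop 0))).exists
  have hEpos : (0 : ℝ) < E.card := (Real.exp_pos _).trans_le hEc
  have hE : E.Nonempty := Finset.card_pos.1 (by exact_mod_cast hEpos)
  obtain ⟨n₀, hn₀⟩ := exists_one_le_coverSum hT hspec hα hθ hθα hε hm₀ hq0 E hE
    (by rwa [show 10 * ε = δ by rw [hεδ]; ring])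
    (hq _ (Real.log_natCast_nonneg _) ((Real.le_log_iff_exp_le hEpos).2 hEc)) x₀
  refine (le_bowenEntropyAt (ε := ε) ?_).trans (le_iSup₂ (f := fun ε (_ : 0 < ε) =>
    bowenEntropyAt T (shadowSet T x₀ α) ε) ε hε)
  exact (one_pos.trans_le ((hn₀ n₀ le_rfl).trans (le_iSup _ n₀))).ne'

end SpecDyn

theorem theorem1p1 {X : Type*} [MetricSpace X] [CompactSpace X] (T : X → X)
    (hT : Continuous T) (hspec : SpecDyn.Specification T) (α : ℝ) (hα : 0 < α) (x₀ : X) :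
    SpecDyn.bowenEntropy T (SpecDyn.shadowSet T x₀ α) =
      Dynamics.coverEntropy T Set.univ / ((1 + α : ℝ) : EReal) := by
  have hα1 : (0 : EReal) < ((1 + α : ℝ) : EReal) := by exact_mod_cast (by positivity : 0 < 1 + α)
  -- Comparison with every real `s` also covers infinite entropy.
  refine le_antisymm (EReal.le_of_forall_lt_iff_le.1 fun s hs => ?_)
    (EReal.ge_of_forall_gt_iff_ge.1 fun s hs => ?_)
  · rw [EReal.div_lt_iff hα1 (EReal.coe_ne_top _), ← EReal.coe_mul] at hs
    exact iSup₂_le fun ε hε => iInf₂_le s (SpecDyn.coverMeasure_shadowSet_eq_zero hα hs hε)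
  · rw [EReal.lt_div_iff hα1 (EReal.coe_ne_top _), ← EReal.coe_mul] at hs
    exact SpecDyn.le_bowenEntropy_shadowSet hT hspec hα x₀ hs
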